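/- Let $S$ be a semigroup. For $s\in S$ let $\varphi^{+}(s)$ (resp. $\varphi^{*}(s)$) be the set of idempotents $e\in S$ with $es=s$ (resp. $se=s$), and order idempotents by $e\le f \iff ef=fe=e$. The semigroup $S$ is *singleton-rich* if for every $s\in S$ both $\varphi^{+}(s)$ and $\varphi^{*}(s)$ have a least element; these are then denoted $s^{+}$ and $s^{*}$. Write $s\ll t$ if $s=s^{+}ts^{*}$; $S$ is *$\ll$-transitive* if $\ll$ is a transitive relation. Put $s\,\sharp\, t=st$ if $s^{*}=t^{+}$, $(st)^{+}=s^{+}$ and $(st)^{*}=t^{*}$, and $s\,\sharp\, t=0$ (an adjoined zero) otherwise. Put $\varphi(s,t)=(s^{*}t)^{+}$ and let $\varphi^{(s,t)}$ be the eventual constant value of the sequence $\varphi_0=\varphi(s,t)$, $\varphi_{k+1}=\varphi(s\varphi_k,\varphi_k t)$. A $\ll$-transitive singleton-rich semigroup $S$ is *$\ll$-smooth* if for all $s''\ll s'\ll s$ and $t''\ll t'\ll t$ in $S$: 1. if $s''\,\sharp\, t''\ne 0$, then $\varphi^{(s''^{+}s',\,t't''^{*})}=\varphi(s''^{+}s',\,t't''^{*})$;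 2. if $s''\,\sharp\, t''\ne 0$, then $(s''^{+}s')^{*}\,t'\,t''^{*}=t''$ if and only if $(s''^{+}s')^{*}\,t\,t''^{*}=t''$; 3. if $s''(s''^{+}s)^{*}=s''$, then $s''(s''^{+}s')^{*}=s''$. For $n\ge 1$, the *layered Catalan monoid* $LC_n$ is the monoid generated by $a_1,\dots,a_n$, with indices read modulo $n$ in $\{1,\dots,n\}$, subject to the relations - $a_i^2=a_i$ for all $i$; - $a_ia_j=a_ja_i$ whenever $j\not\equiv i+1$ and $i\not\equiv j+1 \pmod n$; - $a_ia_{i+1}a_i=a_{i+1}a_ia_{i+1}=a_{i+1}a_i$ for all $1\le i\le n$ (so that $a_na_1a_n=a_1a_na_1=a_1a_n$); - if $n\ge 3$, $a_ia_{i+1}a_{i+2}=a_ia_{i+2}$ for all $1\le i\le n$. **Theorem.** For every $n\ge 1$, the monoid $LC_n$ is $\ll$-smooth. -/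

import Mathlib

namespace LLSmooth

section Semigroup

variable {S : Type*} [Semigroup S]

/-- `φ⁺(s)`: the idempotents that act as left identities on `s`. -/
def phiPlus (s : S) : Set S := {e | IsIdempotentElem e ∧ e * s = s}

/-- `φ*(s)`: the idempotents that act as right identities on `s`. -/
def phiStar (s : S) : Set S := {e | IsIdempotentElem e ∧ s * e = s}

/-- The natural partial order on idempotents: `e ≤ f` if and only if `e f = f e = e`. -/
def IdemLE (e f : S) : Prop := e * f = e ∧ f * e = e

/-- `e` is the least element of the set `A` of idempotents for the natural partial order. -/
def IsLeastIdem (A : Set S) (e : S) : Prop := e ∈ A ∧ ∀ f ∈ A, IdemLE e f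

theorem IsLeastIdem.unique {A : Set S} {e f : S} (he : IsLeastIdem A e) (hf : IsLeastIdem A f) :
    e = f :=
  (he.2 f hf.1).1.symm.trans (hf.2 e he.1).2

variable (S) in
/-- `S` is singleton-rich: for every `s`, both `φ⁺(s)` and `φ*(s)` have a (necessarily unique)
least element. -/
def SingletonRich : Prop :=
  ∀ s : S, (∃ e, IsLeastIdem (phiPlus s) e) ∧ (∃ e, IsLeastIdem (phiStar s) e)

open Classical in
/-- `s⁺`, the least element of `φ⁺(s)`. The value is only meaningful if that element exists, as it
does for every `s` in a singleton-rich semigroup. -/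
noncomputable def plus (s : S) : S :=
  if h : ∃ e, IsLeastIdem (phiPlus s) e then h.choose else s

open Classical in
/-- `s*`, the least element of `φ*(s)`. The value is only meaningful if that element exists, as it
does for every `s` in a singleton-rich semigroup. -/
noncomputable def star (s : S) : S :=
  if h : ∃ e, IsLeastIdem (phiStar s) e then h.choose else s

theorem plus_eq_of_isLeastIdem {s e : S} (h : IsLeastIdem (phiPlus s) e) : plus s = e := by
  have hex : ∃ e, IsLeastIdem (phiPlus s) e := ⟨e, h⟩
  rw [plus, dif_pos hex]
  exact hex.choose_spec.unique h

theorem star_eq_of_isLeastIdem {s e : S} (h : IsLeastIdem (phiStar s) e) : star s = e := by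
  have hex : ∃ e, IsLeastIdem (phiStar s) e := ⟨e, h⟩
  rw [star, dif_pos hex]
  exact hex.choose_spec.unique h

/-- The relation `s ≪ t`, that is, `s = s⁺ t s*`. -/
def LL (s t : S) : Prop := s = plus s * t * star s

variable (S) in
/-- `S` is `≪`-transitive. -/
def LLTransitive : Prop := ∀ s t u : S, LL s t → LL t u → LL s u

open Classical in
/-- The partial product `s ♯ t`: it is `s t` if `s* = t⁺`, `(s t)⁺ = s⁺` and `(s t)* = t*`, and it
is the (adjoined) zero otherwise. -/
noncomputable def sharp (s t : S) : WithZero S :=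
  if star s = plus t ∧ plus (s * t) = plus s ∧ star (s * t) = star t then
    ((s * t : S) : WithZero S)
  else 0

/-- `φ(s, t) = (s* t)⁺`. -/
noncomputable def phi (s t : S) : S := plus (star s * t)

/-- The sequence `φ₀ = φ(s, t)`, `φₖ₊₁ = φ(s φₖ, φₖ t)`. -/
noncomputable def phiSeq (s t : S) : ℕ → S
  | 0 => phi s t
  | k + 1 => phi (s * phiSeq s t k) (phiSeq s t k * t)

/-- `φ^(s, t) = e`: the sequence `φₖ` is eventually constant, with value `e`. -/
def PhiLimitEq (s t e : S) : Prop := ∃ N : ℕ, ∀ k ≥ N, phiSeq s t k = e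

variable (S) in
/-- `S` is `≪`-smooth. -/
structure IsLLSmooth : Prop where
  llTransitive : LLTransitive S
  singletonRich : SingletonRich S
  phi_stable : ∀ s s' s'' t t' t'' : S, LL s'' s' → LL s' s → LL t'' t' → LL t' t →
    sharp s'' t'' ≠ 0 →
    PhiLimitEq (plus s'' * s') (t' * star t'') (phi (plus s'' * s') (t' * star t''))
  right_factor_iff : ∀ s s' s'' t t' t'' : S, LL s'' s' → LL s' s → LL t'' t' → LL t' t →
    sharp s'' t'' ≠ 0 →
    (star (plus s'' * s') * t' * star t'' = t'' ↔ star (plus s'' * s') * t * star t'' = t'')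
  left_factor : ∀ s s' s'' : S, LL s'' s' → LL s' s →
    s'' * star (plus s'' * s) = s'' → s'' * star (plus s'' * s') = s''

end Semigroup

/-- The defining relations of the layered Catalan monoid on the generators `a i`, `i : Fin n`.
Here `i : Fin n` stands for the generator with index `i + 1`, and addition in `Fin n` is modulo
`n`; so the case where `i` is the last element and `i + 1 = 0` gives the relations
`aₙ a₁ aₙ = a₁ aₙ a₁ = a₁ aₙ`, and the generators `a₁` and `aₙ` are not required to commute. -/
inductive LCRel (n : ℕ) [NeZero n] : FreeMonoid (Fin n) → FreeMonoid (Fin n) → Prop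
  | idem (i : Fin n) : LCRel n (.of i * .of i) (.of i)
  | comm (i j : Fin n) (hij : j ≠ i + 1) (hji : i ≠ j + 1) :
      LCRel n (.of i * .of j) (.of j * .of i)
  | braid_left (i : Fin n) :
      LCRel n (.of i * .of (i + 1) * .of i) (.of (i + 1) * .of i)
  | braid_right (i : Fin n) :
      LCRel n (.of (i + 1) * .of i * .of (i + 1)) (.of (i + 1) * .of i)
  /-- The layer relations `aᵢ aᵢ₊₁ aᵢ₊₂ = aᵢ aᵢ₊₂` concern three different consecutive generators,
  so there are none for `n < 3`. -/
  | layer (hn : 3 ≤ n) (i : Fin n) :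
      LCRel n (.of i * .of (i + 1) * .of (i + 2)) (.of i * .of (i + 2))

/-- The layered Catalan monoid `LC_n`, `n ≥ 1`. -/
abbrev LayeredCatalan (n : ℕ) [NeZero n] : Type := PresentedMonoid (LCRel n)

end LLSmooth

/-! The proof orders the monoid compatibly with multiplication, with `1` on top, and derives
smoothness from three properties: `s = s⁺ s*`; `s ≤ t` and `t⁺ ≤ s⁺` force `t⁺ = s⁺`; `s ≤ t`, `t⁺ =
s⁺` and `s* ≤ t*` force `s = t` (`isLLSmooth_of_order`). The first gives `≪`-transitivity by
squeezing. The third shows that `s ≪ t` and `s* ≤ (s⁺t)*` imply `s = s⁺t`, which makes conditions 2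
and 3 collapse; condition 1 uses the last two properties directly.

For `n < 3` the generators commute, and the monoid is a semilattice with `s⁺ = s* = s`. For `n ≥ 3`
the order comes from homomorphisms to `Tag`. The layer relations erase a middle generator, so only
the occurrence of "`i` or `i + 1`" is invariant (`edge`). The only other information that survives
is an isolated ascent: `i` always before `i + 1`, with no letter at `i - 2`, `i - 1`, `i + 2`, `i +
3` other than these two (`up i s = both`). Indeed a word containing `k` and `k + 2` absorbs `k`, `k
+ 1`, `k + 2` on both sides when `n > 3` (`full_ev`), while for `n = 3` the elements can be listed.
Hence `edge` and `up` decide which generators fix `s` on each side (`a_mul_eq_self_iff`,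
`mul_a_eq_self_iff`). These generators yield `s⁺` and `s*`, and `s = s⁺ s*` shows that they
determine `s`, so the order is antisymmetric. -/

namespace LLSmooth

/-! ### Smoothness from a compatible partial order. -/

section Ordered

set_option linter.unusedSectionVars false

variable {M : Type*} [Monoid M]

theorem SingletonRich.plus_spec (h : SingletonRich M) (s : M) :
    IsLeastIdem (phiPlus s) (plus s) := by
  obtain ⟨e, he⟩ := (h s).1
  rwa [plus_eq_of_isLeastIdem he]

theorem SingletonRich.star_spec (h : SingletonRich M) (s : M) :
    IsLeastIdem (phiStar s) (star s) := by
  obtain ⟨e, he⟩ := (h s).2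
  rwa [star_eq_of_isLeastIdem he]

theorem SingletonRich.plus_mul (h : SingletonRich M) (s : M) : plus s * s = s :=
  (h.plus_spec s).1.2

theorem SingletonRich.mul_star (h : SingletonRich M) (s : M) : s * star s = s :=
  (h.star_spec s).1.2

theorem SingletonRich.plus_idem (h : SingletonRich M) (s : M) : plus s * plus s = plus s :=
  (h.plus_spec s).1.1

theorem SingletonRich.star_idem (h : SingletonRich M) (s : M) : star s * star s = star s :=
  (h.star_spec s).1.1

variable [PartialOrder M] [MulLeftMono M] [MulRightMono M]

theorem mul_eq_left_of_idem_le (h1 : ∀ s : M, s ≤ 1) {e f : M} (he : e * e = e) (hef : e ≤ f) :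
    e * f = e :=
  le_antisymm ((mul_le_mul_right (h1 f) e).trans_eq (mul_one e))
    (he.symm.le.trans (mul_le_mul_right hef e))

theorem mul_eq_right_of_idem_le (h1 : ∀ s : M, s ≤ 1) {e f : M} (he : e * e = e) (hef : e ≤ f) :
    f * e = e :=
  le_antisymm ((mul_le_mul_left (h1 f) e).trans_eq (one_mul e))
    (he.symm.le.trans (mul_le_mul_left hef e))

theorem SingletonRich.plus_le (h : SingletonRich M) (h1 : ∀ s : M, s ≤ 1) {s e : M}
    (he : e * e = e) (hs : e * s = s) : plus s ≤ e := by
  have := ((h.plus_spec s).2 e ⟨he, hs⟩).1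
  calc plus s = plus s * e := this.symm
    _ ≤ 1 * e := mul_le_mul_left (h1 _) e
    _ = e := one_mul e

theorem SingletonRich.star_le (h : SingletonRich M) (h1 : ∀ s : M, s ≤ 1) {s e : M}
    (he : e * e = e) (hs : s * e = s) : star s ≤ e := by
  have := ((h.star_spec s).2 e ⟨he, hs⟩).1
  calc star s = star s * e := this.symm
    _ ≤ 1 * e := mul_le_mul_left (h1 _) e
    _ = e := one_mul e

theorem mul_le_left_factor (h1 : ∀ s : M, s ≤ 1) (s t : M) : s * t ≤ s :=
  (mul_le_mul_right (h1 t) s).trans_eq (mul_one s)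

theorem mul_le_right_factor (h1 : ∀ s : M, s ≤ 1) (s t : M) : s * t ≤ t :=
  (mul_le_mul_left (h1 s) t).trans_eq (one_mul t)

/-- If `s ≪ t`, then `s⁺ t` has the same least left identity as `s`. -/
theorem SingletonRich.plus_plus_mul (h : SingletonRich M) (h1 : ∀ s : M, s ≤ 1) {s t : M}
    (hst : LL s t) : plus (plus s * t) = plus s := by
  apply le_antisymm
  · exact h.plus_le h1 (h.plus_idem s) (by rw [← mul_assoc, h.plus_idem])
  · refine h.plus_le h1 (h.plus_idem _) ?_
    have := congrArg (· * star s) (h.plus_mul (plus s * t))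
    simp only [mul_assoc] at this
    rwa [← mul_assoc (plus s), ← show s = plus s * t * star s from hst] at this

/-- A criterion for `≪`-smoothness of a singleton-rich monoid carrying a compatible partial order
whose greatest element is `1`. -/
theorem isLLSmooth_of_order (h1 : ∀ s : M, s ≤ 1) (h : SingletonRich M)
    (hfac : ∀ s : M, plus s * star s = s)
    (hplus : ∀ s t : M, s ≤ t → plus t ≤ plus s → plus t = plus s)
    (hstar : ∀ s t : M, s ≤ t → plus t = plus s → star s ≤ star t → s = t) :
    IsLLSmooth M := by
  have htrans : LLTransitive M := by
    intro s t u hst htu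
    apply le_antisymm
    · calc s = plus s * (plus t * u * star t) * star s := by rw [← htu]; exact hst
        _ ≤ plus s * (1 * u * 1) * star s := by gcongr <;> exact h1 _
        _ = plus s * u * star s := by simp
    · calc plus s * u * star s ≤ plus s * 1 * star s := by gcongr; exact h1 _
        _ = s := by rw [mul_one, hfac]
  have hle : ∀ {s t : M}, LL s t → s ≤ plus s * t := fun {s t} hst =>
    calc s = plus s * t * star s := hst
      _ ≤ plus s * t := mul_le_left_factor h1 _ _
  have hle' : ∀ {s t : M}, LL s t → s ≤ t * star s := fun {s t} hst =>
    calc s = plus s * (t * star s) := by rw [← mul_assoc]; exact hst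
      _ ≤ t * star s := mul_le_right_factor h1 _ _
  -- `s` and `s⁺t` are comparable and share their plus, so a comparison of stars identifies them.
  have hkey : ∀ {s t : M}, LL s t → star s ≤ star (plus s * t) → s = plus s * t :=
    fun {s t} hst hs => hstar _ _ (hle hst) (h.plus_plus_mul h1 hst) hs
  have hsharp : ∀ {s t : M}, sharp s t ≠ 0 →
      star s = plus t ∧ plus (s * t) = plus s ∧ star (s * t) = star t := by
    intro s t hst
    by_contra hc
    exact hst (by rw [sharp, if_neg hc])
  refine ⟨htrans, h, ?_, ?_, ?_⟩
  · intro s s' s'' t t' t'' hs _ ht _ hst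
    obtain ⟨-, hp, -⟩ := hsharp hst
    set a := plus s'' * s' with ha
    set b := t' * star t'' with hb
    have hpa : plus a = plus s'' := h.plus_plus_mul h1 hs
    have hpab : plus (a * b) = plus s'' := by
      rw [← hp]
      refine hplus _ _ (mul_le_mul' (hle hs) (hle' ht)) ?_
      rw [hp]
      exact h.plus_le h1 (h.plus_idem _) (by rw [ha, mul_assoc, ← mul_assoc, h.plus_idem])
    -- With `f = φ(a, b) ≤ a*`, the element `s''⁺f` lies below `s''⁺a* = a` and still has plus
    -- `s''⁺`, because it is a left factor of `ab`. Its star is at most `f`, so it equals `a`,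
    -- whence `a* ≤ f`. The sequence is therefore constant from index `0`.
    have hphi : phi a b = star a := by
      set f := phi a b with hf
      have hfa : f ≤ star a :=
        h.plus_le h1 (h.star_idem a) (by rw [← mul_assoc, h.star_idem])
      refine le_antisymm hfa ?_
      have hff : f * f = f := h.plus_idem _
      have hab : plus s'' * f * (star a * b) = a * b := by
        rw [mul_assoc, hf, phi, h.plus_mul, ← mul_assoc, ← hpa, hfac]
      have hpf : plus (plus s'' * f) = plus s'' := by
        apply le_antisymm
        · exact h.plus_le h1 (h.plus_idem _) (by rw [← mul_assoc, h.plus_idem])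
        · refine hpab.symm.trans_le (h.plus_le h1 (h.plus_idem _) ?_)
          have := congrArg (· * (star a * b)) (h.plus_mul (plus s'' * f))
          simp only [mul_assoc] at this hab
          rwa [hab] at this
      have hsf : star (plus s'' * f) ≤ f := h.star_le h1 hff (by rw [mul_assoc, hff])
      have : plus s'' * f = a := by
        refine hstar _ _ ?_ (hpa.trans hpf.symm) (hsf.trans hfa)
        calc plus s'' * f ≤ plus s'' * star a := mul_le_mul_right hfa _
          _ = a := by rw [← hpa, hfac]
      rwa [this] at hsf
    refine ⟨0, fun k _ => ?_⟩
    rw [hphi]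
    induction k with
    | zero => exact hphi
    | succ k ih =>
      rw [phiSeq, ih k.zero_le, h.mul_star, phi, ← mul_assoc, h.star_idem]
      exact hphi
  · intro s s' s'' t t' t'' hs _ ht htt hst
    obtain ⟨hm, -, -⟩ := hsharp hst
    -- Either equation makes `(s''⁺s')*` a left identity of `t''`, so it lies above `t''⁺ = s''*`
    -- and `hkey` applies.
    have hmain : ∀ {r}, star (plus s'' * s') * r * star t'' = t'' →
        star (plus s'' * s') = plus t'' := by
      intro r hr
      have : star s'' ≤ star (plus s'' * s') := by
        rw [hm]
        refine h.plus_le h1 (h.star_idem _) ?_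
        rw [← hr, ← mul_assoc, ← mul_assoc, h.star_idem]
      rw [← hkey hs this, hm]
    constructor
    · intro hr
      rw [hmain hr]
      exact (htrans _ _ _ ht htt).symm
    · intro hr
      rw [hmain hr]
      exact ht.symm
  · intro s s' s'' hs hss hc
    have hc' : s'' = plus s'' * s := hkey (htrans _ _ _ hs hss) (h.star_le h1 (h.star_idem _) hc)
    have : plus s'' * s' = s'' := by
      refine le_antisymm ?_ (hle hs)
      calc plus s'' * s' = plus s'' * (plus s' * s * star s') := by rw [← hss]
        _ ≤ plus s'' * (1 * s * 1) := by gcongr <;> exact h1 _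
        _ = s'' := by rw [one_mul, mul_one]; exact hc'.symm
    rw [this, h.mul_star]

end Ordered

/-- Commutative monoids of idempotents are `≪`-smooth. -/
theorem isLLSmooth_of_comm_idem {M : Type*} [Monoid M] (hcomm : ∀ s t : M, s * t = t * s)
    (hidem : ∀ s : M, s * s = s) : IsLLSmooth M := by
  let _ : PartialOrder M :=
    { le := fun s t => s * t = s
      le_refl := hidem
      le_trans := fun s t u (hst : s * t = s) (htu : t * u = t) => by
        rw [← hst, mul_assoc, htu]
      le_antisymm := fun s t (hst : s * t = s) (hts : t * s = t) => by
        rw [← hst, hcomm, hts] }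
  have hmul : ∀ a s t : M, s ≤ t → a * s ≤ a * t := fun a s t (hst : s * t = s) => by
    change a * s * (a * t) = a * s
    rw [mul_assoc, ← mul_assoc s, hcomm s a, mul_assoc, hst, ← mul_assoc, hidem]
  have : MulLeftMono M := ⟨hmul⟩
  have : MulRightMono M := ⟨fun a s t hst => by
    simpa only [Function.swap, hcomm _ a] using hmul a s t hst⟩
  have hp : ∀ s : M, IsLeastIdem (phiPlus s) s := fun s =>
    ⟨⟨hidem s, hidem s⟩, fun f hf => ⟨(hcomm _ _).trans hf.2, hf.2⟩⟩
  have hs : ∀ s : M, IsLeastIdem (phiStar s) s := fun s =>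
    ⟨⟨hidem s, hidem s⟩, fun f hf => ⟨hf.2, (hcomm _ _).trans hf.2⟩⟩
  have hp' : ∀ s : M, plus s = s := fun s => plus_eq_of_isLeastIdem (hp s)
  have hs' : ∀ s : M, star s = s := fun s => star_eq_of_isLeastIdem (hs s)
  refine isLLSmooth_of_order (fun s => mul_one s) (fun s => ⟨⟨s, hp s⟩, ⟨s, hs s⟩⟩) ?_ ?_ ?_
  · intro s
    rw [hp', hs', hidem]
  · intro s t hst hts
    rw [hp', hp'] at *
    exact le_antisymm hts hst
  · intro s t _ hst _
    rw [hp', hp'] at hst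
    exact hst.symm

/-! ### The target monoid of the invariants. -/

/-- The five-element monoid `{1, x, y, x y, 0}` with `x² = x`, `y² = y` and `y x = 0`. -/
inductive Tag
  | one | fst | snd | both | zero

namespace Tag

instance : DecidableEq Tag := fun s t => by
  cases s <;> cases t <;> first | exact isTrue rfl | exact isFalse Tag.noConfusion

instance : Fintype Tag := ⟨{one, fst, snd, both, zero}, fun t => by cases t <;> decide⟩

/-- The product of `Tag`. -/
def mul : Tag → Tag → Tag
  | one, t => t
  | t, one => t
  | fst, fst => fst
  | fst, snd => both
  | fst, both => both
  | snd, snd => snd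
  | both, snd => both
  | _, _ => zero

instance : Monoid Tag where
  one := one
  mul := mul
  mul_assoc := by decide
  one_mul := by decide
  mul_one := by decide

/-- The order of `Tag`, with `0 < x y < x, y < 1`. -/
instance : PartialOrder Tag where
  le s t := s = zero ∨ t = one ∨ s = t ∨ (s = both ∧ t ≠ zero)
  le_refl := by decide
  le_trans := by decide
  le_antisymm := by decide

instance (s t : Tag) : Decidable (s ≤ t) :=
  inferInstanceAs (Decidable (s = zero ∨ t = one ∨ s = t ∨ (s = both ∧ t ≠ zero)))

theorem one_def : (1 : Tag) = one := rfl

theorem le_one (s : Tag) : s ≤ 1 := by revert s; decide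

theorem mul_mono : ∀ {s s' t t' : Tag}, s ≤ s' → t ≤ t' → s * t ≤ s' * t' := by decide

theorem zero_mul : ∀ s : Tag, zero * s = zero := by decide

theorem mul_zero : ∀ s : Tag, s * zero = zero := by decide

theorem mul_mul_fst_ne : ∀ s t : Tag, s * (fst * t) ≠ one ∧ s * (fst * t) ≠ snd := by decide

theorem mul_mul_snd_ne : ∀ s t : Tag, s * (snd * t) ≠ one ∧ s * (snd * t) ≠ fst := by decide

theorem sq_ne_both : ∀ t : Tag, t * t ≠ both := by decide

theorem snd_mul_mul_fst_mul : ∀ s t : Tag, snd * (s * (fst * t)) = zero := by decide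

theorem eq_zero_of_le : ∀ {t : Tag}, t ≤ zero → t = zero := by decide

theorem not_both_le_zero : ¬ both ≤ zero := by decide

theorem eq_zero_of_fst_mul_of_snd_mul : ∀ {t : Tag}, fst * t = t → snd * t = t → t = zero := by
  decide

theorem eq_fst_or_eq_both : ∀ {t : Tag}, both ≤ t → fst * t = t → t = fst ∨ t = both := by
  decide

end Tag

/-! ### Words in the generators, with cyclic successor `i ↦ i + g`. -/

section Model

variable {G : Type*} [CommRing G] [DecidableEq G]

/-- The value on the generator `j` of the homomorphism to `Tag` that detects whether `i` and `j`
both occur, isolated from all other neighbours, and with `i` before `i + g`. -/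
def upTag (g i j : G) : Tag :=
  if j = i then .fst else if j = i + g then .snd
  else if j = i - g ∨ j = i - g - g ∨ j = i + g + g ∨ j = i + g + g + g then .zero else .one

/-- The value on the generator `j` of the homomorphism to `Tag` that detects whether `i` or
`i + g` occurs. -/
def edgeTag (g i j : G) : Tag := if j = i ∨ j = i + g then .zero else .one

/-- A monoid with generators `a i` satisfying the relations of the layered Catalan monoid for the
cyclic successor `i ↦ i + g`, together with homomorphisms given on generators by `upTag` and
`edgeTag`. -/
structure LayeredModel (g : G) (M : Type*) [Monoid M] where
  /-- The generators. -/
  a : G → M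
  /-- The homomorphisms detecting isolated ascents. -/
  up : G → M →* Tag
  /-- The homomorphisms detecting occurrences. -/
  edge : G → M →* Tag
  up_a : ∀ i j, up i (a j) = upTag g i j
  edge_a : ∀ i j, edge i (a j) = edgeTag g i j
  exists_word : ∀ s, ∃ w : List G, (w.map a).prod = s
  idem : ∀ i, a i * a i = a i
  comm : ∀ i j, j ≠ i + g → i ≠ j + g → a i * a j = a j * a i
  braid_left : ∀ i, a i * a (i + g) * a i = a (i + g) * a i
  braid_right : ∀ i, a (i + g) * a i * a (i + g) = a (i + g) * a i
  layer : ∀ i, a i * a (i + g) * a (i + g + g) = a i * a (i + g + g)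

namespace LayeredModel

variable {g : G} {M : Type*} [Monoid M] (L : LayeredModel g M)

/-- The element represented by a word. -/
def ev (w : List G) : M := (w.map L.a).prod

@[simp] theorem ev_nil : L.ev [] = 1 := rfl

@[simp] theorem ev_cons (i : G) (w : List G) : L.ev (i :: w) = L.a i * L.ev w := by simp [ev]

@[simp] theorem ev_append (v w : List G) : L.ev (v ++ w) = L.ev v * L.ev w := by simp [ev]

theorem idem_assoc (i : G) (x : M) : L.a i * (L.a i * x) = L.a i * x := by
  rw [← mul_assoc, L.idem]

theorem braid_left_assoc (i : G) (x : M) :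
    L.a i * (L.a (i + g) * (L.a i * x)) = L.a (i + g) * (L.a i * x) := by
  simp only [← mul_assoc, L.braid_left]

theorem braid_right_assoc (i : G) (x : M) :
    L.a (i + g) * (L.a i * (L.a (i + g) * x)) = L.a (i + g) * (L.a i * x) := by
  simp only [← mul_assoc, L.braid_right]

theorem layer_assoc (i : G) (x : M) :
    L.a i * (L.a (i + g) * (L.a (i + g + g) * x)) = L.a i * (L.a (i + g + g) * x) := by
  simp only [← mul_assoc, L.layer]

theorem comm_assoc {i j : G} (h : j ≠ i + g) (h' : i ≠ j + g) (x : M) :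
    L.a i * (L.a j * x) = L.a j * (L.a i * x) := by
  simp only [← mul_assoc, L.comm i j h h']

/-- The left-hand `a k` can be copied across each letter of `v`: past `k - g` by the braid relation,
past any other letter by commutation. Only `k + g` blocks it. -/
theorem mul_ev_mul_right {k : G} : ∀ {v : List G}, k + g ∉ v →
    L.a k * (L.ev v * L.a k) = L.a k * L.ev v
  | [], _ => by simp [L.idem]
  | l :: t, h => by
    have ht : k + g ∉ t := fun hc => h (List.mem_cons_of_mem _ hc)
    have hl : l ≠ k + g := fun hc => h (hc ▸ List.mem_cons_self)
    have ih := mul_ev_mul_right ht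
    simp only [ev_cons, mul_assoc]
    by_cases hk : k = l + g
    · subst hk
      rw [← L.braid_right_assoc, ih, L.braid_right_assoc]
    · rw [L.comm_assoc hl hk, ih, L.comm_assoc hl hk]

theorem mul_ev_mul_left {k : G} : ∀ {v : List G}, k - g ∉ v →
    L.a k * (L.ev v * L.a k) = L.ev v * L.a k
  | [], _ => by simp [L.idem]
  | l :: t, h => by
    have ht : k - g ∉ t := fun hc => h (List.mem_cons_of_mem _ hc)
    have hl : k ≠ l + g := fun hc => h (by rw [hc, add_sub_cancel_right]; exact List.mem_cons_self)
    have ih := mul_ev_mul_left ht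
    simp only [ev_cons, mul_assoc]
    by_cases hk : l = k + g
    · subst hk
      rw [← ih, L.braid_left_assoc]
    · rw [L.comm_assoc hk hl, ih]

theorem commute_ev {x : M} {v : List G} (h : ∀ l ∈ v, Commute (L.a l) x) : Commute (L.ev v) x := by
  induction v with
  | nil => exact Commute.one_left x
  | cons l t ih =>
    rw [ev_cons]
    exact (h l List.mem_cons_self).mul_left (ih fun m hm => h m (List.mem_cons_of_mem _ hm))

theorem exists_ev_eq_mul {c : G} {v : List G} (h : ∀ l ∈ v, Commute (L.a l) (L.a c))
    (hc : c ∈ v) : ∃ v' : List G, c ∉ v' ∧ L.ev v = L.ev v' * L.a c := by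
  induction v with
  | nil => simp at hc
  | cons l t ih =>
    have ht : ∀ m ∈ t, Commute (L.a m) (L.a c) := fun m hm => h m (List.mem_cons_of_mem _ hm)
    by_cases hct : c ∈ t
    · obtain ⟨v', hv', he⟩ := ih ht hct
      by_cases hl : l = c
      · refine ⟨v', hv', ?_⟩
        rw [ev_cons, hl, ← (L.commute_ev ht).eq, he, mul_assoc, L.idem]
      · exact ⟨l :: v', by simp [hv', Ne.symm hl], by rw [ev_cons, ev_cons, he, mul_assoc]⟩
    · have hl : l = c := by
        rcases List.mem_cons.1 hc with h | h
        · exact h.symm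
        · exact absurd h hct
      exact ⟨t, hct, by rw [ev_cons, hl, (L.commute_ev ht).eq]⟩

/-- `s` absorbs the three consecutive generators `k`, `k + g`, `k + 2 g` on both sides. -/
def Full (k : G) (s : M) : Prop :=
  ∀ j, j = k ∨ j = k + g ∨ j = k + g + g → L.a j * s = s ∧ s * L.a j = s

/-! ### Generators at distance two, when the period is not three. -/

section FarApart

variable {L} (h2 : g + g ≠ 0) (h3 : g + g + g ≠ 0)

include h2 h3

theorem mid_mul_pair (k : G) :
    L.a (k + g) * (L.a k * L.a (k + g + g)) = L.a k * L.a (k + g + g) := by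
  have hc : L.a k * L.a (k + g + g) = L.a (k + g + g) * L.a k := L.comm _ _ (by grind) (by grind)
  calc L.a (k + g) * (L.a k * L.a (k + g + g))
      = L.a k * (L.a (k + g) * (L.a k * L.a (k + g + g))) := (L.braid_left_assoc _ _).symm
    _ = L.a k * (L.a (k + g) * (L.a (k + g + g) * L.a k)) := by rw [hc]
    _ = L.a k * (L.a k * L.a (k + g + g)) := by rw [L.layer_assoc, hc]
    _ = _ := L.idem_assoc _ _

theorem pair_mul_mid (k : G) :
    L.a k * (L.a (k + g + g) * L.a (k + g)) = L.a k * L.a (k + g + g) := by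
  have hc : ∀ x, L.a k * (L.a (k + g + g) * x) = L.a (k + g + g) * (L.a k * x) :=
    L.comm_assoc (by grind) (by grind)
  have := L.braid_right (k + g)
  calc L.a k * (L.a (k + g + g) * L.a (k + g))
      = L.a (k + g + g) * (L.a k * (L.a (k + g) * L.a (k + g + g))) := by
        rw [← this, mul_assoc, hc]
    _ = L.a (k + g + g) * (L.a k * L.a (k + g + g)) := by rw [← L.layer k, mul_assoc]
    _ = _ := by rw [← hc, L.idem]

theorem full_pair (k : G) : L.Full k (L.a k * L.a (k + g + g)) := by
  have hc : ∀ x, L.a k * (L.a (k + g + g) * x) = L.a (k + g + g) * (L.a k * x) :=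
    L.comm_assoc (by grind) (by grind)
  rintro j (rfl | rfl | rfl)
  · refine ⟨L.idem_assoc _ _, ?_⟩
    have := hc 1
    simp only [mul_one] at this
    rw [this, mul_assoc, L.idem]
  · exact ⟨mid_mul_pair h2 h3 k, by rw [mul_assoc, pair_mul_mid h2 h3]⟩
  · exact ⟨by rw [← hc, L.idem], by rw [mul_assoc, L.idem]⟩

/-- Together with `Full.mul_right`, this makes the full elements a two-sided ideal, so fullness of a
factor suffices. The delicate case is `l = k - g`, `j = k`: there `s` supplies an `a (k + g)` that
lets `mid_mul_pair` act. -/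
theorem Full.mul_left {k : G} {s : M} (hs : L.Full k s) (l : G) : L.Full k (L.a l * s) := by
  intro j hj
  refine ⟨?_, by rw [mul_assoc, (hs j hj).2]⟩
  by_cases hl : l = j + g
  · subst hl
    rw [← (hs j hj).1, L.braid_left_assoc]
  by_cases hl' : j = l + g
  · rcases hj with h | h
    · have hk : L.a (l + g + g) * s = s := (hs _ (by grind)).1
      subst hl'
      have := mid_mul_pair (L := L) h2 h3 l
      conv_lhs => rw [← hk, ← mul_assoc (L.a l), ← mul_assoc, this, mul_assoc, hk]
    · have hk : L.a l * s = s := (hs _ (by grind)).1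
      rw [hk, (hs j (Or.inr h)).1]
  · rw [L.comm_assoc hl hl', (hs j hj).1]

theorem Full.mul_right {k : G} {s : M} (hs : L.Full k s) (l : G) : L.Full k (s * L.a l) := by
  intro j hj
  refine ⟨by rw [← mul_assoc, (hs j hj).1], ?_⟩
  by_cases hl : j = l + g
  · have := L.braid_right l
    rw [← hl] at this
    rw [← (hs j hj).2, mul_assoc, mul_assoc, ← mul_assoc (L.a j), this, ← mul_assoc]
  by_cases hl' : l = j + g
  · rcases or_assoc.2 hj with h | h
    · have hk : s * L.a l = s := (hs _ (by grind)).2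
      rw [hk, (hs j (or_assoc.1 (Or.inl h))).2]
    · have hk : s * L.a (k + g) = s := (hs _ (by grind)).2
      have := pair_mul_mid (L := L) h2 h3 (k + g)
      rw [← h, ← hl'] at this
      rw [← hk, mul_assoc, mul_assoc, mul_assoc, this]
  · rw [mul_assoc, L.comm _ _ hl hl', ← mul_assoc, (hs j hj).2]

theorem Full.ev_mul {k : G} {s : M} (hs : L.Full k s) : ∀ v : List G, L.Full k (L.ev v * s)
  | [] => by simpa using hs
  | l :: t => by
    rw [ev_cons, mul_assoc]
    exact (Full.ev_mul hs t).mul_left h2 h3 l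

theorem Full.mul_ev {k : G} {s : M} (hs : L.Full k s) (v : List G) : L.Full k (s * L.ev v) := by
  induction v generalizing s with
  | nil => simpa using hs
  | cons l t ih =>
    rw [ev_cons, ← mul_assoc]
    exact ih (hs.mul_right h2 h3 l)

/-- Shrinking `v` removes occurrences of `k` and `k + 2g`. Occurrences of `k + g` then commute with
the rest and merge into one at the right end; `a k` is copied up to it and the layer relation erases
it. -/
theorem full_of_lt (k : G) (v : List G) : L.Full k (L.a k * (L.ev v * L.a (k + g + g))) := by
  by_cases hk : k ∈ v
  · obtain ⟨v₁, v₂, rfl⟩ := List.append_of_mem hk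
    have := (full_of_lt k v₂).ev_mul h2 h3 (k :: v₁)
    simpa [mul_assoc] using this
  by_cases hk2 : k + g + g ∈ v
  · obtain ⟨v₁, v₂, rfl⟩ := List.append_of_mem hk2
    have := (full_of_lt k v₁).mul_ev h2 h3 (v₂ ++ [k + g + g])
    simpa [mul_assoc] using this
  by_cases hk1 : k + g ∈ v
  · obtain ⟨v', hv', he⟩ := L.exists_ev_eq_mul (c := k + g) (v := v) (fun l hl => by
      by_cases h : l = k + g
      · rw [h]
      · exact L.comm _ _ (fun hc => hk (by rwa [add_right_cancel hc])) (fun hc => hk2 (hc ▸ hl)))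
      hk1
    have := (full_pair (L := L) h2 h3 k).ev_mul h2 h3 (k :: v')
    rw [he, mul_assoc, ← mul_assoc, ← L.mul_ev_mul_right hv', mul_assoc, mul_assoc,
      ← mul_assoc (L.a k) (L.a (k + g)), L.layer, ← mul_assoc]
    simpa [mul_assoc] using this
  · have := (full_pair (L := L) h2 h3 k).ev_mul h2 h3 (k :: v)
    rw [← mul_assoc, ← L.mul_ev_mul_right hk1, mul_assoc, mul_assoc, ← mul_assoc]
    simpa [mul_assoc] using this
termination_by v.length
decreasing_by all_goals grind

theorem full_of_gt (k : G) (v : List G) : L.Full k (L.a (k + g + g) * (L.ev v * L.a k)) := by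
  have hc : L.a (k + g + g) * L.a k = L.a k * L.a (k + g + g) := L.comm _ _ (by grind) (by grind)
  have hf := full_pair (L := L) h2 h3 k
  by_cases hk : k ∈ v
  · obtain ⟨v₁, v₂, rfl⟩ := List.append_of_mem hk
    have := (full_of_gt k v₁).mul_ev h2 h3 (v₂ ++ [k])
    simpa [mul_assoc] using this
  by_cases hk2 : k + g + g ∈ v
  · obtain ⟨v₁, v₂, rfl⟩ := List.append_of_mem hk2
    have := (full_of_gt k v₂).ev_mul h2 h3 ((k + g + g) :: v₁)
    simpa [mul_assoc] using this
  -- The pair `k + 2g`, `k + 4g` is itself in increasing order, so `full_of_lt` allows inserting `a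
  -- (k + 2g)` directly before the final `a k`.
  by_cases hk4 : k + g + g + g + g ∈ v
  · obtain ⟨v₁, v₂, rfl⟩ := List.append_of_mem hk4
    have := ((full_of_lt (L := L) h2 h3 (k + g + g) v₁).mul_ev h2 h3 v₂ (k + g + g)
      (Or.inl rfl)).2
    have h' := hf.ev_mul h2 h3 ((k + g + g) :: (v₁ ++ [k + g + g + g + g] ++ v₂))
    rw [← hc] at h'
    simp only [ev_append, ev_cons, ev_nil, mul_one, mul_assoc] at h' this ⊢
    rw [← mul_assoc (L.ev v₂), ← mul_assoc (L.a _) (L.ev v₂ * _), ← mul_assoc (L.ev v₁),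
      ← mul_assoc (L.a (k + g + g))] at h'
    simp only [← mul_assoc] at h' this ⊢
    rwa [this] at h'
  by_cases hk3 : k + g + g + g ∈ v
  · obtain ⟨v', hv', he⟩ := L.exists_ev_eq_mul (c := k + g + g + g) (v := v) (fun l hl => by
      by_cases h : l = k + g + g + g
      · rw [h]
      · exact L.comm _ _ (fun hc => hk2 (by rwa [add_right_cancel hc]))
          (fun hc => hk4 (hc ▸ hl))) hk3
    -- In period four, `k` is `k + 4g` and the layer relation erases the middle letter; otherwise `k
    -- + 3g` commutes with `k` and moves to the right.
    have hd : L.a (k + g + g) * (L.a (k + g + g + g) * L.a k) =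
        L.a k * L.a (k + g + g) * L.ev (if g + g + g + g = 0 then [] else [k + g + g + g]) := by
      split_ifs with h4
      · have := L.layer (k + g + g)
        rw [show k + g + g + g + g = k by grind] at this
        rw [← mul_assoc, this, hc, ev_nil, mul_one]
      · rw [L.comm (k + g + g + g) k (by grind) (by grind), ← mul_assoc, hc]
        simp
    rw [he, ← mul_assoc, ← mul_assoc, ← L.mul_ev_mul_right hv', mul_assoc, mul_assoc, mul_assoc,
      hd]
    have := (hf.ev_mul h2 h3 ((k + g + g) :: v')).mul_ev h2 h3
      (if g + g + g + g = 0 then [] else [k + g + g + g])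
    simpa only [ev_cons, mul_assoc] using this
  · have := hf.ev_mul h2 h3 ((k + g + g) :: v)
    rw [← mul_assoc, ← L.mul_ev_mul_right hk3, mul_assoc, mul_assoc, hc, ← mul_assoc]
    simpa [mul_assoc] using this
termination_by v.length
decreasing_by all_goals grind

theorem full_ev {k l : G} {w : List G} (hk : k ∈ w) (hk2 : l ∈ w) (hl : l = k + g + g) :
    L.Full k (L.ev w) := by
  subst hl
  obtain ⟨w₁, w₂, rfl⟩ := List.append_of_mem hk
  rcases List.mem_append.1 hk2 with h | h
  · obtain ⟨v₁, v₂, rfl⟩ := List.append_of_mem h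
    simpa [mul_assoc] using ((full_of_gt (L := L) h2 h3 k v₂).ev_mul h2 h3 v₁).mul_ev h2 h3 w₂
  · rcases List.mem_cons.1 h with h | h
    · exact absurd h (by grind)
    obtain ⟨v₁, v₂, rfl⟩ := List.append_of_mem h
    simpa [mul_assoc] using ((full_of_lt (L := L) h2 h3 k v₁).ev_mul h2 h3 w₁).mul_ev h2 h3 v₂

end FarApart

/-! ### Values of the invariants on words. -/

theorem edge_ev (i : G) (w : List G) :
    L.edge i (L.ev w) = if i ∈ w ∨ i + g ∈ w then .zero else .one := by
  induction w with
  | nil => simp [Tag.one_def]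
  | cons l t ih =>
    rw [ev_cons, map_mul, ih, L.edge_a, edgeTag]
    by_cases h : l = i ∨ l = i + g
    · rw [if_pos h, Tag.zero_mul, if_pos]
      rcases h with rfl | rfl <;> simp
    · rw [if_neg h]
      have : (i ∈ l :: t ∨ i + g ∈ l :: t) ↔ (i ∈ t ∨ i + g ∈ t) := by
        simp only [List.mem_cons]
        grind
      simp only [this]
      rfl

theorem edge_eq_zero_iff {i : G} {w : List G} :
    L.edge i (L.ev w) = .zero ↔ i ∈ w ∨ i + g ∈ w := by
  rw [edge_ev]
  split_ifs with h <;> simp [h]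

theorem up_ev_of_mem {i l : G} {w : List G} (hl : l ∈ w) :
    ∃ s t, L.up i (L.ev w) = s * (upTag g i l * t) := by
  obtain ⟨w₁, w₂, rfl⟩ := List.append_of_mem hl
  exact ⟨L.up i (L.ev w₁), L.up i (L.ev w₂), by simp [L.up_a]⟩

theorem up_ev_eq_zero {i l : G} {w : List G} (hl : l ∈ w) (h : upTag g i l = .zero) :
    L.up i (L.ev w) = .zero := by
  obtain ⟨s, t, hst⟩ := L.up_ev_of_mem (i := i) hl
  rw [hst, h, Tag.zero_mul, Tag.mul_zero]

/-- The element of `M` generated by `a i` and `a (i + g)` with the given tag. -/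
def ofTag (i : G) : Tag → M
  | .one => 1
  | .fst => L.a i
  | .snd => L.a (i + g)
  | .both => L.a i * L.a (i + g)
  | .zero => L.a (i + g) * L.a i

theorem ofTag_mul_fst (i : G) (t : Tag) : L.ofTag i t * L.a i = L.ofTag i (t * .fst) := by
  cases t
  · exact one_mul _
  · exact L.idem i
  · rfl
  · exact L.braid_left i
  · change L.a (i + g) * L.a i * L.a i = L.a (i + g) * L.a i
    rw [mul_assoc, L.idem]

theorem ofTag_mul_snd (i : G) (t : Tag) : L.ofTag i t * L.a (i + g) = L.ofTag i (t * .snd) := by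
  cases t
  · exact one_mul _
  · rfl
  · exact L.idem (i + g)
  · change L.a i * L.a (i + g) * L.a (i + g) = L.a i * L.a (i + g)
    rw [mul_assoc, L.idem]
  · exact L.braid_right i

/-- A word whose letters are `i`, `i + g` or far from both splits into commuting parts. -/
theorem exists_ev_eq_mul_ofTag (i : G) (w : List G)
    (hw : ∀ l ∈ w, upTag g i l ≠ .zero) :
    ∃ v : M, Commute v (L.a (i + g)) ∧ L.ev w = v * L.ofTag i (L.up i (L.ev w)) := by
  induction w using List.reverseRecOn with
  | nil => exact ⟨1, Commute.one_left _, by simp [Tag.one_def, ofTag]⟩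
  | append_singleton t l ih =>
    obtain ⟨v, hv, he⟩ := ih fun m hm => hw m (by simp [hm])
    have hl := hw l (by simp)
    simp only [ev_append, ev_cons, ev_nil, mul_one, map_mul, L.up_a]
    unfold upTag at hl ⊢
    split_ifs at hl ⊢ with h₁ h₂ h₃
    · exact ⟨v, hv, by rw [← ofTag_mul_fst, ← mul_assoc, ← he, h₁]⟩
    · exact ⟨v, hv, by rw [← ofTag_mul_snd, ← mul_assoc, ← he, h₂]⟩
    · exact absurd rfl hl
    · have hc : Commute (L.a l) (L.a i) := L.comm _ _ (by grind) (by grind)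
      have hc' : Commute (L.a l) (L.a (i + g)) := L.comm _ _ (by grind) (by grind)
      have hct : ∀ t, Commute (L.a l) (L.ofTag i t) := by
        intro t
        cases t
        · exact Commute.one_right _
        · exact hc
        · exact hc'
        · exact hc.mul_right hc'
        · exact hc'.mul_right hc
      refine ⟨v * L.a l, hv.mul_left hc', ?_⟩
      rw [← Tag.one_def, mul_one, mul_assoc, (hct _).eq, ← mul_assoc, ← he]

theorem upTag_self (i : G) : upTag g i i = .fst := if_pos rfl

theorem upTag_succ (hg : g ≠ 0) (i : G) : upTag g i (i + g) = .snd := by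
  rw [upTag, if_neg (by grind), if_pos rfl]

/-- Without `j + g` in the word, copying suffices. With it, any letter near the pair makes the word
absorb `a j` by fullness; otherwise the word splits, and the two-generator part absorbs `a j` unless
it is the ascent. -/
theorem ev_mul_a_of_mem (h2 : g + g ≠ 0) (h3 : g + g + g ≠ 0) {j : G} {w : List G} (hj : j ∈ w)
    (hup : L.up j (L.ev w) ≠ .both) : L.ev w * L.a j = L.ev w := by
  by_cases hj1 : j + g ∈ w
  · by_cases ha : j - g ∈ w
    · exact (full_ev (L := L) h2 h3 ha hj1 (by ring) j (by grind)).2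
    by_cases hb : j + g + g ∈ w
    · exact (full_ev (L := L) h2 h3 hj hb rfl j (by grind)).2
    by_cases hc : j - g - g ∈ w
    · exact (full_ev (L := L) h2 h3 hc hj (by ring) j (by grind)).2
    by_cases hd : j + g + g + g ∈ w
    -- Fullness at `j + g` allows appending `j + 2g`, which together with `j` gives fullness at `j`.
    · have := (full_ev (L := L) h2 h3 hj1 hd rfl (j + g + g) (by grind)).2
      rw [← this]
      have h' := (full_ev (L := L) h2 h3 (k := j) (w := w ++ [j + g + g]) (by simp [hj])
        (by simp) rfl j (by grind)).2
      simpa using h'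
    obtain ⟨v, -, he⟩ := L.exists_ev_eq_mul_ofTag j w (fun l hl => by
      unfold upTag
      split_ifs with h₁ h₂ h₃ <;> grind)
    obtain ⟨s, t, hst⟩ := L.up_ev_of_mem (i := j) hj
    rw [upTag_self] at hst
    have hne := Tag.mul_mul_fst_ne s t
    rw [← hst] at hne
    rw [he, mul_assoc, ofTag_mul_fst]
    congr 2
    generalize L.up j (L.ev w) = t at hup hne ⊢
    cases t <;> simp_all <;> rfl
  · obtain ⟨w₁, w₂, rfl⟩ := List.append_of_mem hj
    have : j + g ∉ w₂ := fun h => hj1 (by simp [h])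
    simp only [ev_append, ev_cons, mul_assoc, L.mul_ev_mul_right this]

theorem a_mul_ev_of_mem (h2 : g + g ≠ 0) (h3 : g + g + g ≠ 0) {i : G} {w : List G}
    (hj : i + g ∈ w) (hup : L.up i (L.ev w) ≠ .both) : L.a (i + g) * L.ev w = L.ev w := by
  by_cases hj1 : i ∈ w
  · by_cases ha : i - g ∈ w
    · exact (full_ev (L := L) h2 h3 ha hj (by ring) (i + g) (by grind)).1
    by_cases hb : i + g + g ∈ w
    · exact (full_ev (L := L) h2 h3 hj1 hb rfl (i + g) (by grind)).1
    by_cases hc : i + g + g + g ∈ w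
    · exact (full_ev (L := L) h2 h3 hj hc rfl (i + g) (by grind)).1
    by_cases hd : i - g - g ∈ w
    · have := (full_ev (L := L) h2 h3 hd hj1 (by ring) (i - g) (by grind)).1
      rw [← this]
      have h' := (full_ev (L := L) h2 h3 (k := i - g) (w := (i - g) :: w) (by simp)
        (List.mem_cons_of_mem _ hj) (by ring) (i + g) (by grind)).1
      simpa using h'
    obtain ⟨v, hv, he⟩ := L.exists_ev_eq_mul_ofTag i w (fun l hl => by
      unfold upTag
      split_ifs with h₁ h₂ h₃ <;> grind)
    obtain ⟨s, t, hst⟩ := L.up_ev_of_mem (i := i) hj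
    rw [upTag_succ (by grind)] at hst
    have hne := Tag.mul_mul_snd_ne s t
    rw [← hst] at hne
    rw [he, ← mul_assoc, ← hv.eq, mul_assoc]
    congr 1
    have : L.up i (L.ev w) = .snd ∨ L.up i (L.ev w) = .zero := by
      generalize L.up i (L.ev w) = t at hup hne ⊢
      cases t <;> simp at hup hne ⊢
    rcases this with h | h
    · rw [h]
      exact L.idem _
    · rw [h]
      exact L.idem_assoc _ _
  · obtain ⟨w₁, w₂, rfl⟩ := List.append_of_mem hj
    have : i + g - g ∉ w₁ := fun h => hj1 (by
      rw [add_sub_cancel_right] at h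
      exact List.mem_append_left _ h)
    have := L.mul_ev_mul_left this
    rw [ev_append, ev_cons, ← mul_assoc (L.ev w₁), ← mul_assoc, this]

/-! ### Period three: ascents and a zero element. -/

section PeriodThree

variable (h3 : g + g + g = 0)

include h3

/-- Since `i = (i + 2g) + g`, the right-hand side is again a descent. All three descents thus
coincide, and their common value is a zero. -/
theorem descent_eq (i : G) : L.a (i + g) * L.a i = L.a i * L.a (i + g + g) := by
  have hi : i + g + g + g = i := by grind
  have h₁ := L.layer i
  have h₂ := L.layer (i + g)
  have h₃ := L.braid_right (i + g + g)
  have h₄ := L.braid_left i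
  rw [hi] at h₂ h₃
  rw [← h₃, ← h₁, mul_assoc, mul_assoc, ← mul_assoc (L.a (i + g)), h₂, ← mul_assoc, h₄]

theorem descent_absorbs (hall : ∀ i j : G, j = i ∨ j = i + g ∨ j = i + g + g) (i j : G) :
    L.a j * (L.a (i + g) * L.a i) = L.a (i + g) * L.a i ∧
      L.a (i + g) * L.a i * L.a j = L.a (i + g) * L.a i := by
  have hi : i + g + g + g = i := by grind
  have h₁ := L.descent_eq h3 i
  have h₂ := L.descent_eq h3 (i + g)
  have h₃ := L.descent_eq h3 (i + g + g)
  rw [hi] at h₂ h₃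
  rcases hall i j with rfl | rfl | rfl
  · exact ⟨by rw [← mul_assoc, L.braid_left], by rw [mul_assoc, L.idem]⟩
  · exact ⟨L.idem_assoc _ _, L.braid_right i⟩
  · exact ⟨by rw [← h₂, L.idem_assoc], by rw [h₁, mul_assoc, L.idem]⟩

theorem eq_one_or_eq_a_or_ascent_or_absorbs
    (hall : ∀ i j : G, j = i ∨ j = i + g ∨ j = i + g + g) (w : List G) :
    L.ev w = 1 ∨ (∃ i, L.ev w = L.a i) ∨ (∃ i, L.ev w = L.a i * L.a (i + g)) ∨
      ∀ j, L.a j * L.ev w = L.ev w ∧ L.ev w * L.a j = L.ev w := by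
  induction w using List.reverseRecOn with
  | nil => exact Or.inl rfl
  | append_singleton t l ih =>
    simp only [ev_append, ev_cons, ev_nil, mul_one]
    rcases ih with h | ⟨i, h⟩ | ⟨i, h⟩ | h
    · exact Or.inr (Or.inl ⟨l, by rw [h, one_mul]⟩)
    · rw [h]
      rcases hall i l with rfl | rfl | rfl
      · exact Or.inr (Or.inl ⟨l, L.idem l⟩)
      · exact Or.inr (Or.inr (Or.inl ⟨i, rfl⟩))
      · rw [← L.descent_eq h3]
        exact Or.inr (Or.inr (Or.inr (L.descent_absorbs h3 hall i)))
    · rw [h]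
      rcases hall i l with rfl | rfl | rfl
      · rw [L.braid_left]
        exact Or.inr (Or.inr (Or.inr (L.descent_absorbs h3 hall l)))
      · exact Or.inr (Or.inr (Or.inl ⟨i, by rw [mul_assoc, L.idem]⟩))
      · rw [L.layer, ← L.descent_eq h3]
        exact Or.inr (Or.inr (Or.inr (L.descent_absorbs h3 hall i)))
    · refine Or.inr (Or.inr (Or.inr fun j => ?_))
      rw [(h l).2]
      exact h j

end PeriodThree

theorem up_ascent (h2 : g + g ≠ 0) (i : G) : L.up i (L.a i * L.a (i + g)) = .both := by
  rw [map_mul, L.up_a, L.up_a, upTag_self, upTag_succ (by grind)]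
  rfl

theorem edge_a_eq_zero_iff {i j : G} : L.edge i (L.a j) = .zero ↔ j = i ∨ j = i + g := by
  rw [L.edge_a, edgeTag]
  split_ifs with h <;> simp [h]

/-! ### Which generators fix an element. -/

section Absorption

variable {L} (h2 : g + g ≠ 0) (h3 : g + g + g = 0 → ∀ i j : G, j = i ∨ j = i + g ∨ j = i + g + g)

include h2 h3

theorem a_mul_eq_self {i : G} {s : M} (he : L.edge i s = .zero) (he' : L.edge (i + g) s = .zero)
    (hu : L.up i s ≠ .both) (hu' : L.up (i + g + g) s ≠ .both) : L.a (i + g) * s = s := by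
  obtain ⟨w, rfl⟩ := L.exists_word s
  change L.a (i + g) * L.ev w = L.ev w
  change L.edge i (L.ev w) = .zero at he
  change L.edge (i + g) (L.ev w) = .zero at he'
  by_cases h : g + g + g = 0
  · rcases L.eq_one_or_eq_a_or_ascent_or_absorbs h (h3 h) w with hw | ⟨j, hw⟩ | ⟨j, hw⟩ | hw
    · rw [hw, map_one] at he
      cases he
    · rw [hw, edge_a_eq_zero_iff] at he he'
      have : j = i + g := by grind
      rw [hw, this, L.idem]
    · change L.up i (L.ev w) ≠ _ at hu
      change L.up (i + g + g) (L.ev w) ≠ _ at hu'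
      rw [hw] at hu hu' ⊢
      rcases h3 h i j with rfl | rfl | rfl
      · exact absurd (L.up_ascent h2 _) hu
      · exact L.idem_assoc _ _
      · exact absurd (L.up_ascent h2 _) hu'
    · exact (hw _).1
  · rw [edge_eq_zero_iff] at he he'
    by_cases hi : i + g ∈ w
    · exact L.a_mul_ev_of_mem h2 h hi hu
    · exact (full_ev (L := L) h2 h (he.resolve_right hi) (he'.resolve_left hi) rfl (i + g)
        (by simp)).1

theorem mul_a_eq_self {i : G} {s : M} (he : L.edge i s = .zero) (he' : L.edge (i + g) s = .zero)
    (hu : L.up (i + g) s ≠ .both) (hu' : L.up (i + g + g) s ≠ .both) : s * L.a (i + g) = s := by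
  obtain ⟨w, rfl⟩ := L.exists_word s
  change L.ev w * L.a (i + g) = L.ev w
  change L.edge i (L.ev w) = .zero at he
  change L.edge (i + g) (L.ev w) = .zero at he'
  by_cases h : g + g + g = 0
  · rcases L.eq_one_or_eq_a_or_ascent_or_absorbs h (h3 h) w with hw | ⟨j, hw⟩ | ⟨j, hw⟩ | hw
    · rw [hw, map_one] at he
      cases he
    · rw [hw, edge_a_eq_zero_iff] at he he'
      have : j = i + g := by grind
      rw [hw, this, L.idem]
    · change L.up (i + g) (L.ev w) ≠ _ at hu
      change L.up (i + g + g) (L.ev w) ≠ _ at hu'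
      rw [hw] at hu hu' ⊢
      rcases h3 h i j with rfl | rfl | rfl
      · rw [mul_assoc, L.idem]
      · exact absurd (L.up_ascent h2 _) hu
      · exact absurd (L.up_ascent h2 _) hu'
    · exact (hw _).2
  · rw [edge_eq_zero_iff] at he he'
    by_cases hi : i + g ∈ w
    · exact L.ev_mul_a_of_mem h2 h hi hu
    · exact (full_ev (L := L) h2 h (he.resolve_right hi) (he'.resolve_left hi) rfl (i + g)
        (by simp)).2

end Absorption

theorem mem_of_up_ev_eq_both {i : G} {w : List G} (h : L.up i (L.ev w) = .both) :
    i ∈ w ∧ i + g ∈ w := by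
  constructor
  · by_contra hi
    suffices L.up i (L.ev w) = .one ∨ L.up i (L.ev w) = .snd ∨ L.up i (L.ev w) = .zero by
      rw [h] at this
      simp at this
    clear h
    induction w with
    | nil => exact Or.inl (map_one _)
    | cons l t ih =>
      simp only [List.mem_cons, not_or] at hi
      have := ih hi.2
      rw [ev_cons, map_mul, L.up_a, upTag, if_neg (Ne.symm hi.1)]
      generalize L.up i (L.ev t) = u at this ⊢
      split_ifs <;> revert this <;> revert u <;> decide
  · by_contra hi
    suffices L.up i (L.ev w) = .one ∨ L.up i (L.ev w) = .fst ∨ L.up i (L.ev w) = .zero by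
      rw [h] at this
      simp at this
    clear h
    induction w with
    | nil => exact Or.inl (map_one _)
    | cons l t ih =>
      simp only [List.mem_cons, not_or] at hi
      have := ih hi.2
      rw [ev_cons, map_mul, L.up_a, upTag, if_neg (Ne.symm hi.1)]
      generalize L.up i (L.ev t) = u at this ⊢
      split_ifs <;> revert this <;> revert u <;> decide

variable {L} (h2 : g + g ≠ 0)
  (h3 : g + g + g = 0 → ∀ i j : G, j = i ∨ j = i + g ∨ j = i + g + g)

theorem edge_of_up_eq_both {i : G} {s : M} (h : L.up i s = .both) :
    L.edge (i - g) s = .zero ∧ L.edge i s = .zero ∧ L.edge (i + g) s = .zero := by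
  obtain ⟨w, rfl⟩ := L.exists_word s
  obtain ⟨h₁, h₂⟩ := L.mem_of_up_ev_eq_both h
  exact ⟨L.edge_eq_zero_iff.2 (Or.inr (by rwa [sub_add_cancel])),
    L.edge_eq_zero_iff.2 (Or.inl h₁), L.edge_eq_zero_iff.2 (Or.inl h₂)⟩

theorem upTag_add_self (h2 : g + g ≠ 0) (i : G) : upTag g (i + g) i = .zero := by
  unfold upTag
  split_ifs <;> grind

theorem up_of_up_eq_both (h2 : g + g ≠ 0) {i : G} {s : M} (h : L.up i s = .both) :
    L.up (i - g) s = .zero ∧ L.up (i + g) s = .zero ∧ L.up (i + g + g) s = .zero := by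
  obtain ⟨w, rfl⟩ := L.exists_word s
  obtain ⟨h₁, h₂⟩ := L.mem_of_up_ev_eq_both h
  refine ⟨L.up_ev_eq_zero h₂ ?_, L.up_ev_eq_zero h₁ (upTag_add_self h2 i),
    L.up_ev_eq_zero h₂ (upTag_add_self h2 (i + g))⟩
  unfold upTag
  split_ifs <;> grind

theorem edge_self_a (j : G) : L.edge (j - g) (L.a j) = .zero ∧ L.edge j (L.a j) = .zero :=
  ⟨L.edge_a_eq_zero_iff.2 (Or.inr (by ring)), L.edge_a_eq_zero_iff.2 (Or.inl rfl)⟩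

theorem up_add_a (h2 : g + g ≠ 0) (j : G) : L.up (j + g) (L.a j) = .zero := by
  rw [L.up_a, upTag_add_self h2]

theorem up_sub_a (h2 : g + g ≠ 0) (j : G) : L.up (j - g) (L.a j) = .snd := by
  have := L.up_a (j - g) (j - g + g)
  rwa [upTag_succ (by grind), sub_add_cancel] at this

theorem up_self_a (j : G) : L.up j (L.a j) = .fst := by
  rw [L.up_a, upTag_self]

section Left

theorem fst_mul_up {j : G} {s : M} (h : L.a j * s = s) : Tag.fst * L.up j s = L.up j s := by
  rw [← up_self_a (L := L) j, ← map_mul, h]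

include h2

theorem snd_mul_up {j : G} {s : M} (h : L.a (j + g) * s = s) :
    Tag.snd * L.up j s = L.up j s := by
  have := up_sub_a (L := L) h2 (j + g)
  rw [add_sub_cancel_right] at this
  rw [← this, ← map_mul, h]

theorem up_add_eq_zero {j : G} {s : M} (h : L.a j * s = s) : L.up (j + g) s = .zero := by
  rw [← h, map_mul, up_add_a h2, Tag.zero_mul]

include h3

/-- The `edge` conditions say that a word for `s` contains `j` or both its neighbours. The condition
at `j + g` restricts further only in period three, where `j - g = j + 2g`; otherwise a letter `j -
g` or `j` already makes that tag zero. -/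
theorem a_mul_eq_self_iff {j : G} {s : M} : L.a j * s = s ↔
    L.edge (j - g) s = .zero ∧ L.edge j s = .zero ∧
      L.up (j - g) s ≠ .both ∧ L.up (j + g) s ≠ .both := by
  constructor
  · intro h
    refine ⟨?_, ?_, fun hc => ?_, ?_⟩
    · rw [← h, map_mul, (edge_self_a j).1, Tag.zero_mul]
    · rw [← h, map_mul, (edge_self_a j).2, Tag.zero_mul]
    · rw [← h, map_mul, up_sub_a h2] at hc
      revert hc
      generalize L.up (j - g) s = t
      revert t
      decide
    · rw [up_add_eq_zero h2 h]
      decide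
  · rintro ⟨h₁, h₂, h₃, h₄⟩
    have := a_mul_eq_self (L := L) (i := j - g) (s := s) h2 h3
    simp only [sub_add_cancel] at this
    exact this h₁ h₂ h₃ h₄

theorem mul_a_eq_self_iff {j : G} {s : M} : s * L.a j = s ↔
    L.edge (j - g) s = .zero ∧ L.edge j s = .zero ∧
      L.up j s ≠ .both ∧ L.up (j + g) s ≠ .both := by
  constructor
  · intro h
    refine ⟨?_, ?_, fun hc => ?_, ?_⟩
    · rw [← h, map_mul, (edge_self_a j).1, Tag.mul_zero]
    · rw [← h, map_mul, (edge_self_a j).2, Tag.mul_zero]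
    · rw [← h, map_mul, up_self_a] at hc
      revert hc
      generalize L.up j s = t
      revert t
      decide
    · rw [← h, map_mul, up_add_a h2, Tag.mul_zero]
      decide
  · rintro ⟨h₁, h₂, h₃, h₄⟩
    have := mul_a_eq_self (L := L) (i := j - g) (s := s) h2 h3
    simp only [sub_add_cancel] at this
    exact this h₁ h₂ h₃ h₄

theorem a_mul_of_up_eq_both {i : G} {s : M} (h : L.up i s = .both) : L.a i * s = s := by
  obtain ⟨h₁, h₂, -⟩ := edge_of_up_eq_both h
  obtain ⟨h₃, h₄, -⟩ := up_of_up_eq_both h2 h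
  exact (a_mul_eq_self_iff h2 h3).2 ⟨h₁, h₂, by rw [h₃]; decide, by rw [h₄]; decide⟩

theorem mul_a_of_up_eq_both {i : G} {s : M} (h : L.up i s = .both) : s * L.a (i + g) = s := by
  obtain ⟨-, h₁, h₂⟩ := edge_of_up_eq_both h
  obtain ⟨-, h₃, h₄⟩ := up_of_up_eq_both h2 h
  exact (mul_a_eq_self_iff h2 h3).2
    ⟨by rwa [add_sub_cancel_right], h₂, by rw [h₃]; decide, by rw [h₄]; decide⟩

end Left

theorem ev_mul_of_forall {s : M} {w : List G} (h : ∀ l ∈ w, L.a l * s = s) : L.ev w * s = s := by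
  induction w with
  | nil => exact one_mul s
  | cons l t ih =>
    rw [ev_cons, mul_assoc, ih fun m hm => h m (List.mem_cons_of_mem _ hm), h l List.mem_cons_self]

theorem mul_ev_of_forall {s : M} {w : List G} (h : ∀ l ∈ w, s * L.a l = s) : s * L.ev w = s := by
  induction w with
  | nil => exact mul_one s
  | cons l t ih =>
    rw [ev_cons, ← mul_assoc, h l List.mem_cons_self,
      ih fun m hm => h m (List.mem_cons_of_mem _ hm)]

/-! ### Least identities, factorization and the order. -/

section Finite

variable [Fintype G]

open Classical in
/-- The generators in `A`, in some order. -/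
noncomputable def wordOf (A : Set G) : List G := (Finset.univ.filter (· ∈ A)).toList

omit [CommRing G] [DecidableEq G] in
theorem mem_wordOf {A : Set G} {j : G} : j ∈ wordOf A ↔ j ∈ A := by
  classical
  simp [wordOf]

variable (L) in
/-- The idempotent generated by the generators in `A`. -/
noncomputable def idemOf (A : Set G) : M := L.ev (wordOf A) * L.ev (wordOf A)

theorem idemOf_mul {A : Set G} {s : M} (h : ∀ j ∈ A, L.a j * s = s) : L.idemOf A * s = s := by
  have := ev_mul_of_forall (L := L) (s := s) (w := wordOf A) fun l hl => h l (mem_wordOf.1 hl)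
  rw [idemOf, mul_assoc, this, this]

theorem mul_idemOf {A : Set G} {s : M} (h : ∀ j ∈ A, s * L.a j = s) : s * L.idemOf A = s := by
  have := mul_ev_of_forall (L := L) (s := s) (w := wordOf A) fun l hl => h l (mem_wordOf.1 hl)
  rw [idemOf, ← mul_assoc, this, this]

theorem edge_idemOf {A : Set G} {j : G} (hj : j ∈ A) :
    L.edge (j - g) (L.idemOf A) = .zero ∧ L.edge j (L.idemOf A) = .zero := by
  have h₁ : L.edge (j - g) (L.ev (wordOf A)) = .zero :=
    L.edge_eq_zero_iff.2 (Or.inr (by rwa [sub_add_cancel, mem_wordOf]))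
  have h₂ : L.edge j (L.ev (wordOf A)) = .zero := L.edge_eq_zero_iff.2 (Or.inl (mem_wordOf.2 hj))
  rw [idemOf, map_mul, map_mul, h₁, h₂]
  decide

/-- This is why `idemOf` squares its word: an ascent is not a square in `Tag`, so every generator in
`A` is absorbed on both sides, whatever order the list has. -/
theorem up_idemOf_ne (A : Set G) (j : G) : L.up j (L.idemOf A) ≠ .both := by
  rw [idemOf, map_mul]
  exact Tag.sq_ne_both _

variable (L) in
/-- The generators acting trivially on `s` from the left. -/
def leftSet (s : M) : Set G := {j | L.a j * s = s}

variable (L) in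
/-- The generators acting trivially on `s` from the right. -/
def rightSet (s : M) : Set G := {j | s * L.a j = s}

include h2 h3

theorem a_mul_idemOf {A : Set G} {j : G} (hj : j ∈ A) : L.a j * L.idemOf A = L.idemOf A :=
  (a_mul_eq_self_iff h2 h3).2
    ⟨(edge_idemOf hj).1, (edge_idemOf hj).2, up_idemOf_ne A _, up_idemOf_ne A _⟩

theorem idemOf_mul_a {A : Set G} {j : G} (hj : j ∈ A) : L.idemOf A * L.a j = L.idemOf A :=
  (mul_a_eq_self_iff h2 h3).2
    ⟨(edge_idemOf hj).1, (edge_idemOf hj).2, up_idemOf_ne A _, up_idemOf_ne A _⟩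

theorem idemOf_mul_self (A : Set G) : L.idemOf A * L.idemOf A = L.idemOf A :=
  idemOf_mul fun _ hj => a_mul_idemOf h2 h3 hj

theorem idemOf_leftSet_mul_idemOf_rightSet (s : M) :
    L.idemOf (L.leftSet s) * L.idemOf (L.rightSet s) = s := by
  -- Letters of a word for `s` are deleted from the left. A letter fixing `s` on the left is
  -- absorbed by the first idempotent. Any other is the top `i + g` of an isolated ascent; the
  -- nonzero tag excludes `i` and `i + 2g` after it, so it moves right and is absorbed by the second
  -- idempotent.
  have key : ∀ c : List G,
      (∀ l ∈ c, l ∈ L.leftSet s ∨ ∃ i, l = i + g ∧ L.up i s = .both) →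
      (∀ i, L.up i s = .both → L.up i (L.ev c) ≠ .zero) →
      L.idemOf (L.leftSet s) * (L.ev c * L.idemOf (L.rightSet s)) =
        L.idemOf (L.leftSet s) * L.idemOf (L.rightSet s) := by
    intro c
    induction c with
    | nil => simp
    | cons l t ih =>
      intro hl hz
      have ih' := ih (fun m hm => hl m (List.mem_cons_of_mem _ hm)) fun i hi hc =>
        hz i hi (by rw [ev_cons, map_mul, hc, Tag.mul_zero])
      rcases hl l List.mem_cons_self with h | ⟨i, rfl, hi⟩
      · rw [ev_cons, mul_assoc, ← mul_assoc, idemOf_mul_a h2 h3 h, ih']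
      · have hne := hz i hi
        rw [ev_cons, map_mul, L.up_a, upTag_succ (by grind)] at hne
        have hcomm : Commute (L.ev t) (L.a (i + g)) := by
          refine L.commute_ev fun k hk => L.comm _ _ ?_ ?_
          · rintro hki
            rw [← add_right_cancel hki] at hk
            obtain ⟨x, y, hxy⟩ := L.up_ev_of_mem (i := i) hk
            rw [upTag_self] at hxy
            exact hne (by rw [hxy, Tag.snd_mul_mul_fst_mul])
          · rintro rfl
            refine hne ?_
            rw [L.up_ev_eq_zero hk, Tag.mul_zero]
            unfold upTag
            split_ifs <;> grind
        rw [ev_cons, ← hcomm.eq, mul_assoc,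
          a_mul_idemOf h2 h3 (A := L.rightSet s) (mul_a_of_up_eq_both h2 h3 hi), ih']
  obtain ⟨w, hw⟩ := L.exists_word s
  change L.ev w = s at hw
  have := key w (fun l hl => by
      by_cases h : L.up (l - g) s = .both
      · exact Or.inr ⟨l - g, by rw [sub_add_cancel], h⟩
      · refine Or.inl ((a_mul_eq_self_iff h2 h3).2 ⟨?_, ?_, h, ?_⟩)
        · rw [← hw]
          exact L.edge_eq_zero_iff.2 (Or.inr (by rwa [sub_add_cancel]))
        · rw [← hw]
          exact L.edge_eq_zero_iff.2 (Or.inl hl)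
        · rw [← hw, L.up_ev_eq_zero hl (upTag_add_self h2 l)]
          decide) (fun i hi => by rw [hw, hi]; decide)
  rw [← this, hw, mul_idemOf (A := L.rightSet s) fun _ hj => hj,
    idemOf_mul (A := L.leftSet s) fun _ hj => hj]

theorem eq_of_leftSet_eq_of_rightSet_eq {s t : M} (hl : L.leftSet s = L.leftSet t)
    (hr : L.rightSet s = L.rightSet t) : s = t := by
  rw [← idemOf_leftSet_mul_idemOf_rightSet h2 h3 s, hl, hr,
    idemOf_leftSet_mul_idemOf_rightSet h2 h3 t]

theorem eq_of_edge_eq_of_up_eq {s t : M} (he : ∀ i, L.edge i s = L.edge i t)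
    (hu : ∀ i, L.up i s = L.up i t) : s = t := by
  apply eq_of_leftSet_eq_of_rightSet_eq h2 h3
  · ext j
    exact (a_mul_eq_self_iff h2 h3).trans (by
      rw [he, he, hu, hu]
      exact (a_mul_eq_self_iff h2 h3).symm)
  · ext j
    exact (mul_a_eq_self_iff h2 h3).trans (by
      rw [he, he, hu, hu]
      exact (mul_a_eq_self_iff h2 h3).symm)

variable (L) in
/-- The order comparing the values of all the homomorphisms to `Tag`. -/
@[reducible] def partialOrder : PartialOrder M where
  le s t := (∀ i, L.edge i s ≤ L.edge i t) ∧ ∀ i, L.up i s ≤ L.up i t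
  le_refl s := ⟨fun _ => le_rfl, fun _ => le_rfl⟩
  le_trans s t u hst htu :=
    ⟨fun i => (hst.1 i).trans (htu.1 i), fun i => (hst.2 i).trans (htu.2 i)⟩
  le_antisymm s t hst hts := eq_of_edge_eq_of_up_eq h2 h3
    (fun i => le_antisymm (hst.1 i) (hts.1 i)) (fun i => le_antisymm (hst.2 i) (hts.2 i))

theorem isLLSmooth (L : LayeredModel g M) : IsLLSmooth M := by
  let _ : PartialOrder M := L.partialOrder h2 h3
  have : MulLeftMono M := ⟨fun a s t hst =>
    ⟨fun i => by simpa only [map_mul] using Tag.mul_mono le_rfl (hst.1 i),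
      fun i => by simpa only [map_mul] using Tag.mul_mono le_rfl (hst.2 i)⟩⟩
  have : MulRightMono M := ⟨fun a s t hst =>
    ⟨fun i => by simpa only [map_mul, Function.swap] using Tag.mul_mono (hst.1 i) le_rfl,
      fun i => by simpa only [map_mul, Function.swap] using Tag.mul_mono (hst.2 i) le_rfl⟩⟩
  have h1 : ∀ s : M, s ≤ 1 := fun s =>
    ⟨fun i => by rw [map_one]; exact Tag.le_one _, fun i => by rw [map_one]; exact Tag.le_one _⟩
  -- If a product fixes `s`, so does each factor, since `s ≤ a l * s ≤ s`. Thus left identities are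
  -- words in `leftSet s`.
  have hleft : ∀ {w : List G} {s : M}, L.ev w * s = s → ∀ l ∈ w, L.a l * s = s := by
    intro w s hs l hl
    obtain ⟨w₁, w₂, rfl⟩ := List.append_of_mem hl
    refine le_antisymm (mul_le_right_factor h1 _ _) ?_
    calc s = L.ev w₁ * (L.a l * (L.ev w₂ * s)) := by
          conv_lhs => rw [← hs]
          simp [mul_assoc]
      _ ≤ 1 * (L.a l * (1 * s)) := by gcongr <;> exact h1 _
      _ = L.a l * s := by simp
  have hright : ∀ {w : List G} {s : M}, s * L.ev w = s → ∀ l ∈ w, s * L.a l = s := by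
    intro w s hs l hl
    obtain ⟨w₁, w₂, rfl⟩ := List.append_of_mem hl
    refine le_antisymm (mul_le_left_factor h1 _ _) ?_
    calc s = s * L.ev w₁ * L.a l * L.ev w₂ := by
          conv_lhs => rw [← hs]
          simp [mul_assoc]
      _ ≤ s * 1 * L.a l * 1 := by gcongr <;> exact h1 _
      _ = s * L.a l := by simp
  have hplus : ∀ s, IsLeastIdem (phiPlus s) (L.idemOf (L.leftSet s)) := by
    refine fun s => ⟨⟨idemOf_mul_self h2 h3 _, idemOf_mul fun j hj => hj⟩, fun f hf => ?_⟩
    obtain ⟨w, rfl⟩ := L.exists_word f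
    have hw := hleft hf.2
    exact ⟨mul_ev_of_forall fun l hl => idemOf_mul_a h2 h3 (hw l hl),
      ev_mul_of_forall fun l hl => a_mul_idemOf h2 h3 (hw l hl)⟩
  have hstar : ∀ s, IsLeastIdem (phiStar s) (L.idemOf (L.rightSet s)) := by
    refine fun s => ⟨⟨idemOf_mul_self h2 h3 _, mul_idemOf fun j hj => hj⟩, fun f hf => ?_⟩
    obtain ⟨w, rfl⟩ := L.exists_word f
    have hw := hright hf.2
    exact ⟨mul_ev_of_forall fun l hl => idemOf_mul_a h2 h3 (hw l hl),
      ev_mul_of_forall fun l hl => a_mul_idemOf h2 h3 (hw l hl)⟩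
  have hrich : SingletonRich M := fun s => ⟨⟨_, hplus s⟩, ⟨_, hstar s⟩⟩
  have hpe : ∀ s, plus s = L.idemOf (L.leftSet s) := fun s => plus_eq_of_isLeastIdem (hplus s)
  have hse : ∀ s, star s = L.idemOf (L.rightSet s) := fun s => star_eq_of_isLeastIdem (hstar s)
  have hlp : ∀ {s t : M}, plus t ≤ plus s → ∀ j, L.a j * s = s → L.a j * t = t := by
    intro s t hts j hj
    have h₁ : L.a j * plus s = plus s := by rw [hpe]; exact a_mul_idemOf h2 h3 hj
    rw [← hrich.plus_mul t, ← mul_eq_right_of_idem_le h1 (hrich.plus_idem t) hts, ← mul_assoc,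
      ← mul_assoc, h₁]
  have hrs : ∀ {s t : M}, star t ≤ star s → ∀ j, s * L.a j = s → t * L.a j = t := by
    intro s t hts j hj
    have h₁ : star s * L.a j = star s := by rw [hse]; exact idemOf_mul_a h2 h3 hj
    rw [← hrich.mul_star t, ← mul_eq_left_of_idem_le h1 (hrich.star_idem t) hts, mul_assoc,
      mul_assoc, h₁]
  have hedge : ∀ {s t : M}, s ≤ t → ∀ {i}, L.edge i t = .zero → L.edge i s = .zero :=
    fun hst i hi => Tag.eq_zero_of_le (hi ▸ hst.1 i)
  have hup : ∀ {s t : M}, s ≤ t → ∀ {i}, L.up i t = .zero → L.up i s = .zero :=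
    fun hst i hi => Tag.eq_zero_of_le (hi ▸ hst.2 i)
  refine isLLSmooth_of_order h1 hrich ?_ ?_ ?_
  · intro s
    rw [hpe, hse, idemOf_leftSet_mul_idemOf_rightSet h2 h3]
  · intro s t hst hts
    refine le_antisymm hts ?_
    -- The only obstruction is an ascent of `s` at `j - g`. Then `a (j - g)` fixes `s`, hence `t`,
    -- as `a j` does, so the tag of `t` is zero, which is not above `both`.
    have hsub : ∀ j ∈ L.leftSet t, L.a j * s = s := by
      intro j hj
      have hj' : L.a j * t = t := hj
      obtain ⟨h₁, h₂, -, -⟩ := (a_mul_eq_self_iff h2 h3).1 hj'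
      refine (a_mul_eq_self_iff h2 h3).2 ⟨hedge hst h₁, hedge hst h₂, fun hc => ?_, ?_⟩
      · have h₃ := fst_mul_up (hlp hts _ (a_mul_of_up_eq_both h2 h3 hc))
        have h₄ := snd_mul_up (L := L) (j := j - g) h2 (by rwa [sub_add_cancel])
        have := hst.2 (j - g)
        rw [hc, Tag.eq_zero_of_fst_mul_of_snd_mul h₃ h₄] at this
        exact Tag.not_both_le_zero this
      · rw [hup hst (up_add_eq_zero h2 hj')]
        decide
    have : plus t * plus s = plus s := by
      rw [hpe t]
      refine idemOf_mul fun j hj => ?_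
      rw [hpe s]
      exact a_mul_idemOf h2 h3 (hsub j hj)
    rw [← this]
    exact mul_le_left_factor h1 _ _
  · intro h k hhk hp hs
    have hlk : ∀ j, L.a j * h = h → L.a j * k = k := hlp hp.le
    have hlh : ∀ j, L.a j * k = k → L.a j * h = h := hlp hp.ge
    have hrh : ∀ j, k * L.a j = k → h * L.a j = h := hrs hs
    -- An ascent of `k` missing in `h` would make `a (i + g)` fix `h`, hence `k`, on the left,
    -- contradicting `snd * both = zero`.
    have hboth : ∀ i, L.up i k = .both → L.up i h = .both := by
      intro i hi
      by_contra hc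
      obtain ⟨-, h₁, h₂⟩ := edge_of_up_eq_both hi
      obtain ⟨-, -, h₃⟩ := up_of_up_eq_both h2 hi
      have : L.a (i + g) * h = h := by
        refine (a_mul_eq_self_iff h2 h3).2 ⟨?_, hedge hhk h₂, ?_, ?_⟩
        · rw [add_sub_cancel_right]
          exact hedge hhk h₁
        · rwa [add_sub_cancel_right]
        · rw [hup hhk h₃]
          decide
      have := snd_mul_up h2 (hlk _ this)
      rw [hi] at this
      revert this
      decide
    have hrk : ∀ j, h * L.a j = h → k * L.a j = k := by
      intro j hj
      obtain ⟨h₁, h₂, h₃, h₄⟩ := (mul_a_eq_self_iff h2 h3).1 hj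
      suffices L.edge (j - g) k = .zero ∧ L.edge j k = .zero from
        (mul_a_eq_self_iff h2 h3).2 ⟨this.1, this.2, fun hc => h₃ (hboth _ hc),
          fun hc => h₄ (hboth _ hc)⟩
      -- For an ascent of `h` at `j - g`, the tag of `k` is `fst` or `both`. The value `fst` would
      -- make `a (j - g)` fix `k`, hence `h`, on the right, which the ascent forbids. Without an
      -- ascent, left absorption transfers the `edge` values.
      by_cases hu : L.up (j - g) h = .both
      · have hk := hlk _ (a_mul_of_up_eq_both h2 h3 hu)
        rcases Tag.eq_fst_or_eq_both (hu ▸ hhk.2 (j - g)) (fst_mul_up hk) with hf | hb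
        · obtain ⟨h₅, h₆, -, h₇⟩ := (a_mul_eq_self_iff h2 h3).1 hk
          have := hrh _ ((mul_a_eq_self_iff h2 h3).2 ⟨h₅, h₆, by rw [hf]; decide, h₇⟩)
          exact absurd hu ((mul_a_eq_self_iff h2 h3).1 this).2.2.1
        · have := edge_of_up_eq_both hb
          rw [sub_add_cancel] at this
          exact this.2
      · have := (a_mul_eq_self_iff h2 h3).1 (hlk _ ((a_mul_eq_self_iff h2 h3).2 ⟨h₁, h₂, hu, h₄⟩))
        exact ⟨this.1, this.2.1⟩
    apply eq_of_leftSet_eq_of_rightSet_eq h2 h3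
    · exact Set.ext fun j => ⟨hlk j, hlh j⟩
    · exact Set.ext fun j => ⟨hrk j, hrh j⟩

end Finite

end LayeredModel

end Model

/-! ### Compatibility of the tags with the relations. -/

section Tags

variable {G : Type*} [CommRing G] [DecidableEq G] {g : G}

theorem upTag_idem (i j : G) : upTag g i j * upTag g i j = upTag g i j := by
  unfold upTag
  split_ifs <;> decide

theorem upTag_comm {i j k : G} (hjk : k ≠ j + g) (hkj : j ≠ k + g) :
    upTag g i j * upTag g i k = upTag g i k * upTag g i j := by
  unfold upTag
  split_ifs <;> first | decide | (exfalso; grind)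

theorem upTag_braid (h2 : g + g ≠ 0) (i j : G) :
    upTag g i j * upTag g i (j + g) * upTag g i j = upTag g i (j + g) * upTag g i j ∧
      upTag g i (j + g) * upTag g i j * upTag g i (j + g) = upTag g i (j + g) * upTag g i j := by
  unfold upTag
  split_ifs <;> first | decide | (exfalso; grind)

/-- This relation forces the zeros at `i - 2g` and `i + 3g`: erasing the zero letter `i - g` or `i +
2g` must leave a zero product. -/
theorem upTag_layer (h2 : g + g ≠ 0) (i j : G) :
    upTag g i j * upTag g i (j + g) * upTag g i (j + g + g) =
      upTag g i j * upTag g i (j + g + g) := by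
  unfold upTag
  split_ifs <;> first | decide | (exfalso; grind)

theorem edgeTag_idem (i j : G) : edgeTag g i j * edgeTag g i j = edgeTag g i j := by
  unfold edgeTag
  split_ifs <;> decide

theorem edgeTag_comm (i j k : G) :
    edgeTag g i j * edgeTag g i k = edgeTag g i k * edgeTag g i j := by
  unfold edgeTag
  split_ifs <;> decide

theorem edgeTag_layer (i j : G) :
    edgeTag g i j * edgeTag g i (j + g) * edgeTag g i (j + g + g) =
      edgeTag g i j * edgeTag g i (j + g + g) := by
  unfold edgeTag
  split_ifs <;> first | decide | (exfalso; grind)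

end Tags

theorem fin_two_eq_add_one : ∀ i j : Fin 2, j = i + 1 → i = j + 1 := by decide

theorem fin_three_cases : ∀ i j : Fin 3, j = i ∨ j = i + 1 ∨ j = i + 1 + 1 := by decide

/-! ### The presented monoid and the cases of `n`. -/

section Presentation

variable {n : ℕ} [NeZero n]

theorem exists_word_layeredCatalan (s : LayeredCatalan n) :
    ∃ w : List (Fin n), (w.map (PresentedMonoid.of (LCRel n))).prod = s := by
  induction s using PresentedMonoid.inductionOn with
  | h w =>
    refine ⟨w.toList, ?_⟩
    induction w using FreeMonoid.inductionOn' with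
    | one => rfl
    | of_mul x w ih =>
      rw [FreeMonoid.toList_of_mul, List.map_cons, List.prod_cons, ih, map_mul]
      rfl

open Fin.CommRing in
/-- The layered Catalan monoid on at least three generators as a `LayeredModel`. -/
noncomputable def layeredModel (hn : 3 ≤ n) (h2 : (1 : Fin n) + 1 ≠ 0) :
    LayeredModel (1 : Fin n) (LayeredCatalan n) where
  a := PresentedMonoid.of (LCRel n)
  up i := PresentedMonoid.lift (upTag 1 i) (by
    have h12 : ∀ j : Fin n, j + 2 = j + 1 + 1 := fun j => by rw [add_assoc, one_add_one_eq_two]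
    rintro _ _ (j | ⟨j, k, hjk, hkj⟩ | j | j | ⟨-, j⟩) <;>
      simp only [map_mul, FreeMonoid.lift_eval_of, h12]
    · exact upTag_idem i j
    · exact upTag_comm hjk hkj
    · exact (upTag_braid h2 i j).1
    · exact (upTag_braid h2 i j).2
    · exact upTag_layer h2 i j)
  edge i := PresentedMonoid.lift (edgeTag 1 i) (by
    have h12 : ∀ j : Fin n, j + 2 = j + 1 + 1 := fun j => by rw [add_assoc, one_add_one_eq_two]
    rintro _ _ (j | ⟨j, k, -, -⟩ | j | j | ⟨-, j⟩) <;>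
      simp only [map_mul, FreeMonoid.lift_eval_of, h12]
    · exact edgeTag_idem i j
    · exact edgeTag_comm i j k
    · rw [edgeTag_comm i j, mul_assoc, edgeTag_idem]
    · rw [mul_assoc, edgeTag_comm i j, ← mul_assoc, edgeTag_idem]
    · exact edgeTag_layer i j)
  up_a _ _ := rfl
  edge_a _ _ := rfl
  exists_word := exists_word_layeredCatalan
  idem i := PresentedMonoid.mk_eq_mk_of_rel (.idem i)
  comm i j hij hji := PresentedMonoid.mk_eq_mk_of_rel (.comm i j hij hji)
  braid_left i := PresentedMonoid.mk_eq_mk_of_rel (.braid_left i)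
  braid_right i := PresentedMonoid.mk_eq_mk_of_rel (.braid_right i)
  layer i := by
    rw [add_assoc, one_add_one_eq_two]
    exact PresentedMonoid.mk_eq_mk_of_rel (.layer hn i)

theorem layeredCatalan_comm_idem (hn : n < 3) :
    (∀ s t : LayeredCatalan n, s * t = t * s) ∧ ∀ s : LayeredCatalan n, s * s = s := by
  have hgen : ∀ i j : Fin n, Commute (PresentedMonoid.of (LCRel n) i)
      (PresentedMonoid.of (LCRel n) j) := by
    intro i j
    by_cases hij : j = i + 1
    · by_cases hji : i = j + 1
      -- When each index succeeds the other, the two braid relations evaluate `a j * a i * a j` as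
      -- both `a j * a i` and `a i * a j`.
      · have h₁ := PresentedMonoid.mk_eq_mk_of_rel (LCRel.braid_right i)
        have h₂ := PresentedMonoid.mk_eq_mk_of_rel (LCRel.braid_left j)
        rw [← hij] at h₁
        rw [← hji] at h₂
        exact h₂.symm.trans h₁
      · exfalso
        have := NeZero.ne n
        have : n = 1 ∨ n = 2 := by omega
        rcases this with rfl | rfl
        · exact hji (Subsingleton.elim _ _)
        · exact hji (fin_two_eq_add_one i j hij)
    · by_cases hji : i = j + 1
      · exfalso
        have := NeZero.ne n
        have : n = 1 ∨ n = 2 := by omega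
        rcases this with rfl | rfl
        · exact hij (Subsingleton.elim _ _)
        · exact hij (fin_two_eq_add_one j i hji)
      · exact PresentedMonoid.mk_eq_mk_of_rel (LCRel.comm i j hij hji)
  have hlist : ∀ (x : LayeredCatalan n) (w : List (Fin n)),
      (∀ i, Commute x (PresentedMonoid.of (LCRel n) i)) →
      Commute x (w.map (PresentedMonoid.of (LCRel n))).prod := by
    intro x w h
    refine Commute.list_prod_right _ _ fun y hy => ?_
    obtain ⟨i, -, rfl⟩ := List.mem_map.1 hy
    exact h i
  have hcomm : ∀ s t : LayeredCatalan n, Commute s t := by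
    intro s t
    obtain ⟨v, rfl⟩ := exists_word_layeredCatalan s
    obtain ⟨w, rfl⟩ := exists_word_layeredCatalan t
    exact hlist _ _ fun i => (hlist _ _ fun j => hgen i j).symm
  refine ⟨hcomm, fun s => ?_⟩
  obtain ⟨w, rfl⟩ := exists_word_layeredCatalan s
  induction w with
  | nil => exact one_mul 1
  | cons i t ih =>
    have hi : PresentedMonoid.of (LCRel n) i * PresentedMonoid.of (LCRel n) i =
        PresentedMonoid.of (LCRel n) i := PresentedMonoid.mk_eq_mk_of_rel (LCRel.idem i)
    rw [List.map_cons, List.prod_cons]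
    exact ((hcomm _ _).mul_mul_mul_comm _ _).trans (by rw [hi, ih])

open Fin.CommRing in
theorem isLLSmooth_layeredCatalan (n : ℕ) [NeZero n] : IsLLSmooth (LayeredCatalan n) := by
  rcases lt_or_ge n 3 with hn | hn
  · obtain ⟨hcomm, hidem⟩ := layeredCatalan_comm_idem hn
    exact isLLSmooth_of_comm_idem hcomm hidem
  · have h2 : (1 : Fin n) + 1 ≠ 0 := by
      intro h
      have := congrArg Fin.val h
      rw [Fin.val_add, Fin.val_one', Fin.val_zero, Nat.mod_eq_of_lt (by omega : 1 < n),
        Nat.mod_eq_of_lt (by omega)] at this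
      omega
    refine (layeredModel hn h2).isLLSmooth h2 fun h3 => ?_
    have hn3 : n = 3 := by
      by_contra hne
      have := congrArg Fin.val h3
      rw [Fin.val_add, Fin.val_add, Fin.val_one', Fin.val_zero,
        Nat.mod_eq_of_lt (by omega : 1 < n), Nat.mod_eq_of_lt (by omega : 1 + 1 < n),
        Nat.mod_eq_of_lt (by omega)] at this
      omega
    subst hn3
    exact fin_three_cases

end Presentation

end LLSmooth

theorem theorem3p10 (n : ℕ) [NeZero n] : LLSmooth.IsLLSmooth (LLSmooth.LayeredCatalan n) := by
  exact LLSmooth.isLLSmooth_layeredCatalan n
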